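/- Let $(\mathbf C,\otimes,I,\dagger)$ be a (locally small) dagger compact closed category: a symmetric monoidal category with an identity-on-objects, contravariant, involutive operation $\dagger$ on morphisms such that $(f\otimes g)^\dagger=f^\dagger\otimes g^\dagger$, the associators, unitors and braidings $\beta$ are dagger isomorphisms (isomorphisms $i$ with $i^{-1}=i^\dagger$), and every object $X$ has a dagger dual, i.e. an object $X^*$ and a morphism $\eta_X\colon I\to X^*\otimes X$ that, together with $\varepsilon_X=\eta_X^\dagger\circ\beta_{X,X^*}\colon X\otimes X^*\to I$, satisfies both triangle equations. A morphism $m$ is dagger monic if $m^\dagger\circ m=\mathrm{id}$, and a dagger kernel is a dagger monic kernel $k$ of some morphism; write $k^\perp$ for a dagger monic kernel of $k^\dagger$. Assume that 1. each family of objects, indexed by a set, has a dagger biproduct (an object that is both a product and a coproduct of the family, with projections $p_\alpha$ and injections $i_\alpha$ such that $p_\alpha\circ i_\alpha=\mathrm{id}$, $p_\alpha\circ i_\beta=0$ for $\alpha\ne\beta$, and $p_\alpha=i_\alpha^\dagger$), where the zero morphisms are those that factor through the zero object, the biproduct of the empty family; 2. each morphism has a kernel that is dagger monic; 3. $k$ and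 $k^\perp$ are jointly epic for each dagger kernel $k$; 4. $I$ is not a zero object; 5. each nonzero morphism $I\to I$ is invertible; 6. $I$ is a separator. For a family of morphisms $r_\alpha\colon X\to Y$, $\alpha \in M$, put $\sum_\alpha r_\alpha=\Delta_Y^\dagger\circ\bigl(\bigoplus_\alpha r_\alpha\bigr)\circ\Delta_X$, where $\Delta_X\colon X\to\bigoplus_{\alpha\in M} X$ is the diagonal, and for $r,s\colon X\to Y$ write $r\le s$ if $r+s=s$. For each object $X$ let $E(X)$ be the set of atoms of $\mathbf C(I,X)$ for this order, that is, the set of nonzero $x\colon I\to X$ such that every $b\le x$ is $0$ or $x$. For each $r\colon X\to Y$ let $E(r)=\{(x,y)\in E(X)\times E(Y)\mid y^\dagger\circ r\circ x=\mathrm{id}_I\}$. Then $E$ is a dagger equivalence from $\mathbf C$ to the dagger category $\mathbf{Rel}$ of sets and binary relations (with converse as dagger). That is, $E$ is a functor, $E(r^\dagger)=E(r)^\dagger$ for every morphism $r$, $E$ is full and faithful, and every set is dagger isomorphic in $\mathbf{Rel}$ to $E(X)$ for some object $X$ of $\mathbf C$. Indeed, for every set $M$, if $X$ is any dagger biproduct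 of copies of $I$ indexed by $M$, then $M$ is dagger isomorphic to $E(X)$. -/

import Mathlib

open CategoryTheory CategoryTheory.Limits MonoidalCategory

universe v u

/-- A dagger category: a category with an involutive, identity-on-objects, contravariant
operation on morphisms. -/
class DaggerCategory (C : Type u) [Category.{v} C] where
  /-- The dagger of a morphism. -/
  dagger : ∀ {X Y : C}, (X ⟶ Y) → (Y ⟶ X)
  dagger_id : ∀ X : C, dagger (𝟙 X) = 𝟙 X
  dagger_dagger : ∀ {X Y : C} (f : X ⟶ Y), dagger (dagger f) = f
  dagger_comp : ∀ {X Y Z : C} (f : X ⟶ Y) (g : Y ⟶ Z), dagger (f ≫ g) = dagger g ≫ dagger f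

namespace DaggerCategory

/-! ### Special morphisms in a dagger category -/

section Basic

variable {C : Type u} [Category.{v} C] [DaggerCategory C]

/-- `m` is a dagger monomorphism: `m† ∘ m` is the identity. -/
def IsDaggerMono {X Y : C} (m : X ⟶ Y) : Prop :=
  m ≫ dagger m = 𝟙 X

/-- `i` is a dagger isomorphism: `i†` is a two-sided inverse of `i`. -/
def IsDaggerIso {X Y : C} (i : X ⟶ Y) : Prop :=
  i ≫ dagger i = 𝟙 X ∧ dagger i ≫ i = 𝟙 Y

/-- `f` and `g` are jointly epic. -/
def JointlyEpic {A B X : C} (f : A ⟶ X) (g : B ⟶ X) : Prop :=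
  ∀ ⦃Z : C⦄ (r s : X ⟶ Z), f ≫ r = f ≫ s → g ≫ r = g ≫ s → r = s

variable [HasZeroMorphisms C]

/-- `k` is a kernel of `f`. -/
def IsKernelOf {K X Y : C} (k : K ⟶ X) (f : X ⟶ Y) : Prop :=
  ∃ w : k ≫ f = 0, Nonempty (IsLimit (KernelFork.ofι k w))

/-- `k` is a dagger kernel: it is a dagger monomorphism and a kernel of some morphism. -/
def IsDaggerKernel {K X : C} (k : K ⟶ X) : Prop :=
  IsDaggerMono k ∧ ∃ (Y : C) (f : X ⟶ Y), IsKernelOf k f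

/-- `k'` is (a representative of) the complement `k^⊥ = ker (k†)`, as a dagger kernel. -/
def IsComplementOf {K' K X : C} (k' : K' ⟶ X) (k : K ⟶ X) : Prop :=
  IsDaggerMono k' ∧ IsKernelOf k' (dagger k)

end Basic

/-! ### Dagger biproducts and sums of morphisms -/

/-- A dagger biproduct of the family `F`: an object that is a product and a coproduct of the
family, with `p_j ∘ i_j = id`, with `p_k ∘ i_j = 0` for `j ≠ k`, and with `p_j = i_j†`. -/
structure DaggerBiproduct {C : Type u} [Category.{v} C] [DaggerCategory C] [HasZeroMorphisms C]
    {J : Type v} (F : J → C) where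
  /-- The object, the projections `π` and the injections `ι`. -/
  bicone : Bicone F
  /-- It is both a product and a coproduct. -/
  isBilimit : bicone.IsBilimit
  dagger_ι : ∀ j, dagger (bicone.ι j) = bicone.π j

/-- Every (small) family of objects has a dagger biproduct. -/
class HasDaggerBiproducts (C : Type u) [Category.{v} C] [DaggerCategory C]
    [HasZeroMorphisms C] : Prop where
  exists_biproduct : ∀ {J : Type v} (F : J → C), Nonempty (DaggerBiproduct F)

section Sums

variable {C : Type u} [Category.{v} C] [DaggerCategory C] [HasZeroMorphisms C]

namespace DaggerBiproduct

/-- The underlying object of a dagger biproduct. -/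
abbrev pt {J : Type v} {F : J → C} (A : DaggerBiproduct F) : C :=
  A.bicone.pt

/-- The diagonal morphism `Δ : X ⟶ ⨁_{j ∈ J} X`. -/
def diag {J : Type v} {X : C} (A : DaggerBiproduct (fun _ : J => X)) : X ⟶ A.pt :=
  A.isBilimit.isLimit.lift (Fan.mk X fun _ => 𝟙 X)

/-- The morphism `⨁ r_j : ⨁ F_j ⟶ ⨁ G_j`. -/
def map {J : Type v} {F G : J → C} (A : DaggerBiproduct F) (B : DaggerBiproduct G)
    (r : ∀ j, F j ⟶ G j) : A.pt ⟶ B.pt :=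
  B.isBilimit.isLimit.lift (Fan.mk A.pt fun j => A.bicone.π j ≫ r j)

end DaggerBiproduct

variable [HasDaggerBiproducts C]

/-- A chosen dagger biproduct of a family. -/
noncomputable def chosenBiproduct {J : Type v} (F : J → C) : DaggerBiproduct F :=
  Classical.choice (HasDaggerBiproducts.exists_biproduct F)

/-- The sum `∑ r_j = Δ† ∘ (⨁ r_j) ∘ Δ` of a family of morphisms `X ⟶ Y`. -/
noncomputable def homSum {J : Type v} {X Y : C} (r : J → (X ⟶ Y)) : X ⟶ Y :=
  (chosenBiproduct fun _ : J => X).diag ≫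
    (chosenBiproduct fun _ : J => X).map (chosenBiproduct fun _ : J => Y) r ≫
      dagger (chosenBiproduct fun _ : J => Y).diag

/-- The sum `r + s` of two parallel morphisms. -/
noncomputable def homAdd {X Y : C} (r s : X ⟶ Y) : X ⟶ Y :=
  homSum fun j : ULift.{v} Bool => bif j.down then r else s

/-- The order on morphisms `X ⟶ Y`: `r ≤ s` if `r + s = s`. -/
def HomLE {X Y : C} (r s : X ⟶ Y) : Prop :=
  homAdd r s = s

/-- `a` is an atom of the hom-set for the order `HomLE`, whose least element is `0`. -/
def IsHomAtom {X Y : C} (a : X ⟶ Y) : Prop :=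
  a ≠ 0 ∧ ∀ b : X ⟶ Y, HomLE b a → b = 0 ∨ b = a

end Sums

/-! ### Dagger compact closed categories -/

/-- Compatibility of the dagger with a symmetric monoidal structure: the monoidal product is a
dagger functor, and the associators, unitors and braidings are dagger isomorphisms. -/
class DaggerSymmetric (C : Type u) [Category.{v} C] [MonoidalCategory C] [SymmetricCategory C]
    [DaggerCategory C] : Prop where
  dagger_tensor : ∀ {X₁ Y₁ X₂ Y₂ : C} (f : X₁ ⟶ Y₁) (g : X₂ ⟶ Y₂),
    dagger (f ⊗ₘ g) = dagger f ⊗ₘ dagger g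
  dagger_associator : ∀ X Y Z : C, dagger (α_ X Y Z).hom = (α_ X Y Z).inv
  dagger_leftUnitor : ∀ X : C, dagger (λ_ X).hom = (λ_ X).inv
  dagger_rightUnitor : ∀ X : C, dagger (ρ_ X).hom = (ρ_ X).inv
  dagger_braiding : ∀ X Y : C, dagger (β_ X Y).hom = (β_ X Y).inv

/-- A dagger compact closed category: a dagger symmetric monoidal category in which every object
`X` has a dagger dual, that is, an object `X'` and a morphism `η : I ⟶ X' ⊗ X` that satisfies both
triangle equations together with the counit `ε = η† ∘ β_{X,X'} : X ⊗ X' ⟶ I`. -/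
class DaggerCompactClosed (C : Type u) [Category.{v} C] [MonoidalCategory C]
    [SymmetricCategory C] [DaggerCategory C] : Prop extends DaggerSymmetric C where
  exists_daggerDual : ∀ X : C, ∃ (X' : C) (_ : ExactPairing X' X),
    ε_ X' X = (β_ X X').hom ≫ dagger (η_ X' X)

/-! ### The dagger category of sets and relations; dagger equivalences -/

/-- In the category of sets and relations, the dagger is the converse relation. -/
instance instRelCat : DaggerCategory RelCat.{v} where
  dagger r := RelCat.Hom.ofRel r.rel.inv
  dagger_id X := by
    apply RelCat.Hom.ext
    ext ⟨a, b⟩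
    exact eq_comm
  dagger_dagger _ := rfl
  dagger_comp f g := by
    apply RelCat.Hom.ext
    ext ⟨a, b⟩
    exact exists_congr fun _ => and_comm

/-- A dagger equivalence: a full and faithful functor that preserves the dagger, such that every
object of the target is dagger isomorphic to the image of some object. -/
structure IsDaggerEquivalence {C : Type*} [Category* C] [DaggerCategory C] {D : Type*}
    [Category* D] [DaggerCategory D] (F : C ⥤ D) : Prop where
  full : F.Full
  faithful : F.Faithful
  map_dagger : ∀ {X Y : C} (f : X ⟶ Y), F.map (dagger f) = dagger (F.map f)
  exists_daggerIso : ∀ M : D, ∃ (X : C) (i : M ⟶ F.obj X), IsDaggerIso i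

/-! ### The atoms of an object -/

section Atoms

variable (C : Type u) [Category.{v} C] [MonoidalCategory C] [DaggerCategory C]
  [HasZeroMorphisms C] [HasDaggerBiproducts C]

/-- The data of `E` on objects and on morphisms: `E(X)` is the set of atoms of `C(I, X)`, and
`E(r) = {(x, y) | y† ∘ r ∘ x = 1}`. No functoriality is claimed here. -/
def atomPrefunctor : C ⥤q RelCat.{v} where
  obj X := ({x : 𝟙_ C ⟶ X // IsHomAtom x} : Type v)
  map {X Y} r := RelCat.Hom.ofRel
    {p : {x : 𝟙_ C ⟶ X // IsHomAtom x} × {y : 𝟙_ C ⟶ Y // IsHomAtom y} |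
      p.1.1 ≫ r ≫ dagger p.2.1 = 𝟙 (𝟙_ C)}

end Atoms

end DaggerCategory

/-!
Zero-sum-freeness of the hom-sets (an Eilenberg swindle) forces every scalar to be `0` or `1`, so
sums of morphisms are suprema for the order `r ≤ s ↔ r + s = s`, and every `Hom(I, X)` is a complete
Boolean algebra in which `x` and `y` are disjoint exactly when `y† ∘ x = 0`.

Closedness carries complements from `Hom(I, [X, X])` to `Hom(X, X)`. A complement `n` of `id_X`
satisfies `y ∨ n(y) = ⊤` for every `y ≠ 0`. If `y` is not an atom, it contains disjoint nonzero `b`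
and `c`, and `n(y) = (n(y) ∨ b) ∧ (n(y) ∨ c) = ⊤`. Hence if no atom lay below some `x ≠ 0`, the
projection onto `x` would be below both `n` and `id_X`. So `Hom(I, X)` is atomic, and a morphism
is determined by its matrix of scalars between atoms, which is a binary relation.
-/

namespace DaggerCategory

section Dagger

variable {C : Type u} [Category.{v} C] [DaggerCategory C] [HasZeroMorphisms C]

@[simp]
theorem dagger_zero (X Y : C) : dagger (0 : X ⟶ Y) = 0 := by
  rw [← zero_comp (X := X) (f := dagger (0 : Y ⟶ X)), dagger_comp, dagger_dagger, zero_comp]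

theorem dagger_eq_zero_iff {X Y : C} {f : X ⟶ Y} : dagger f = 0 ↔ f = 0 :=
  ⟨fun h => by rw [← dagger_dagger f, h, dagger_zero], fun h => by rw [h, dagger_zero]⟩

theorem comp_dagger_eq_zero_comm {X Y Z : C} {f : X ⟶ Y} {g : Z ⟶ Y} :
    f ≫ dagger g = 0 ↔ g ≫ dagger f = 0 := by
  rw [← dagger_eq_zero_iff, dagger_comp, dagger_dagger]

end Dagger

namespace DaggerBiproduct

variable {C : Type u} [Category.{v} C] [DaggerCategory C] [HasZeroMorphisms C] {J : Type v}
  {F G : J → C} (A : DaggerBiproduct F) (B : DaggerBiproduct G)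

theorem hom_ext_π {X : C} {f g : X ⟶ A.pt} (h : ∀ j, f ≫ A.bicone.π j = g ≫ A.bicone.π j) :
    f = g :=
  Fan.IsLimit.hom_ext A.isBilimit.isLimit _ _ h

theorem hom_ext_ι {X : C} {f g : A.pt ⟶ X} (h : ∀ j, A.bicone.ι j ≫ f = A.bicone.ι j ≫ g) :
    f = g :=
  Cofan.IsColimit.hom_ext A.isBilimit.isColimit _ _ h

theorem exists_lift {X : C} (r : ∀ j, X ⟶ F j) : ∃ u : X ⟶ A.pt, ∀ j, u ≫ A.bicone.π j = r j :=
  ⟨Fan.IsLimit.lift A.isBilimit.isLimit r, Fan.IsLimit.fac A.isBilimit.isLimit r⟩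

theorem exists_desc {X : C} (r : ∀ j, F j ⟶ X) : ∃ u : A.pt ⟶ X, ∀ j, A.bicone.ι j ≫ u = r j :=
  ⟨Cofan.IsColimit.desc A.isBilimit.isColimit r, Cofan.IsColimit.fac A.isBilimit.isColimit r⟩

theorem map_π (r : ∀ j, F j ⟶ G j) (j : J) :
    A.map B r ≫ B.bicone.π j = A.bicone.π j ≫ r j :=
  B.isBilimit.isLimit.fac _ ⟨j⟩

theorem ι_map (r : ∀ j, F j ⟶ G j) (j : J) :
    A.bicone.ι j ≫ A.map B r = r j ≫ B.bicone.ι j := by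
  refine B.hom_ext_π fun k => ?_
  rw [Category.assoc, Category.assoc, map_π]
  rcases eq_or_ne j k with rfl | hjk
  · simp
  · rw [bicone_ι_π_ne_assoc _ hjk, bicone_ι_π_ne _ hjk, zero_comp, comp_zero]

variable {X : C} (D : DaggerBiproduct fun _ : J => X)

theorem diag_π (j : J) : D.diag ≫ D.bicone.π j = 𝟙 X :=
  D.isBilimit.isLimit.fac _ ⟨j⟩

theorem ι_dagger_diag (j : J) : D.bicone.ι j ≫ dagger D.diag = 𝟙 X := by
  rw [← dagger_dagger (D.bicone.ι j), ← dagger_comp, D.dagger_ι, diag_π, dagger_id]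

end DaggerBiproduct

section Sums

variable {C : Type u} [Category.{v} C] [DaggerCategory C] [HasZeroMorphisms C]
  [HasDaggerBiproducts C] {W X Y Z : C} {J K : Type v}

theorem homSum_eq_comp_dagger_diag {r : J → (X ⟶ Y)}
    {u : X ⟶ (chosenBiproduct fun _ : J => Y).pt}
    (hu : ∀ j, u ≫ (chosenBiproduct fun _ : J => Y).bicone.π j = r j) :
    homSum r = u ≫ dagger (chosenBiproduct fun _ : J => Y).diag := by
  rw [homSum, ← Category.assoc]
  congr 1
  refine DaggerBiproduct.hom_ext_π _ fun j => ?_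
  rw [hu, Category.assoc, DaggerBiproduct.map_π, ← Category.assoc, DaggerBiproduct.diag_π,
    Category.id_comp]

theorem homSum_eq_diag_comp {r : J → (X ⟶ Y)}
    {t : (chosenBiproduct fun _ : J => X).pt ⟶ Y}
    (ht : ∀ j, (chosenBiproduct fun _ : J => X).bicone.ι j ≫ t = r j) :
    homSum r = (chosenBiproduct fun _ : J => X).diag ≫ t := by
  rw [homSum]
  congr 1
  refine DaggerBiproduct.hom_ext_ι _ fun j => ?_
  rw [ht, ← Category.assoc, DaggerBiproduct.ι_map, Category.assoc, DaggerBiproduct.ι_dagger_diag,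
    Category.comp_id]

theorem comp_homSum (f : X ⟶ Y) (r : J → (Y ⟶ Z)) :
    f ≫ homSum r = homSum fun j => f ≫ r j := by
  obtain ⟨u, hu⟩ := (chosenBiproduct fun _ : J => Z).exists_lift r
  have hfu (j : J) : (f ≫ u) ≫ (chosenBiproduct fun _ : J => Z).bicone.π j = f ≫ r j := by
    rw [Category.assoc, hu]
  rw [homSum_eq_comp_dagger_diag hu, homSum_eq_comp_dagger_diag hfu, Category.assoc]

theorem homSum_comp (r : J → (X ⟶ Y)) (g : Y ⟶ Z) :
    homSum r ≫ g = homSum fun j => r j ≫ g := by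
  obtain ⟨t, ht⟩ := (chosenBiproduct fun _ : J => X).exists_desc r
  have htg (j : J) : (chosenBiproduct fun _ : J => X).bicone.ι j ≫ t ≫ g = r j ≫ g := by
    rw [← Category.assoc, ht]
  rw [homSum_eq_diag_comp ht, homSum_eq_diag_comp htg, Category.assoc]

theorem homSum_comm (m : J → K → (X ⟶ Y)) :
    (homSum fun j => homSum (m j)) = homSum fun k => homSum fun j => m j k := by
  choose t ht using fun j => (chosenBiproduct fun _ : K => Y).exists_lift (m j)
  have hsum (k : K) : homSum t ≫ (chosenBiproduct fun _ : K => Y).bicone.π k =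
      homSum fun j => m j k := by
    simp only [homSum_comp, ht]
  rw [homSum_eq_comp_dagger_diag hsum, homSum_comp]
  exact congrArg homSum (funext fun j => homSum_eq_comp_dagger_diag (ht j))

theorem homSum_eq_single {r : J → (X ⟶ Y)} (k : J) (h : ∀ j, j ≠ k → r j = 0) :
    homSum r = r k := by
  have hk (j : J) : (r k ≫ (chosenBiproduct fun _ : J => Y).bicone.ι k) ≫
      (chosenBiproduct fun _ : J => Y).bicone.π j = r j := by
    rcases eq_or_ne j k with rfl | hj
    · simp
    · rw [Category.assoc, bicone_ι_π_ne _ hj.symm, comp_zero, h j hj]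
  rw [homSum_eq_comp_dagger_diag hk, Category.assoc, DaggerBiproduct.ι_dagger_diag,
    Category.comp_id]

theorem homSum_ite_eq [DecidableEq J] (k : J) (r : J → (X ⟶ Y)) :
    (homSum fun j => if j = k then r j else 0) = r k :=
  (homSum_eq_single k fun _ hj => if_neg hj).trans (if_pos rfl)

theorem homSum_zero : homSum (fun _ : J => (0 : X ⟶ Y)) = 0 := by
  rw [homSum_eq_comp_dagger_diag fun j => zero_comp, zero_comp]

theorem homSum_comp_injective {e : J → K} (he : e.Injective) {r : K → (X ⟶ Y)}
    (hr : ∀ k ∉ Set.range e, r k = 0) : (homSum fun j => r (e j)) = homSum r := by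
  classical
  have hcol (k : K) : (homSum fun j => if k = e j then r k else 0) = r k := by
    by_cases hk : k ∈ Set.range e
    · obtain ⟨j, rfl⟩ := hk
      rw [homSum_eq_single j fun i hi => if_neg (he.ne hi.symm), if_pos rfl]
    · simp only [hr k hk, ite_self, homSum_zero]
  simpa only [homSum_ite_eq, hcol] using homSum_comm fun j k => if k = e j then r k else 0

theorem comp_homAdd (f : X ⟶ Y) (r s : Y ⟶ Z) :
    f ≫ homAdd r s = homAdd (f ≫ r) (f ≫ s) := by
  rw [homAdd, comp_homSum, homAdd]
  congr 1
  funext ⟨j⟩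
  cases j <;> rfl

theorem homAdd_comp (r s : X ⟶ Y) (g : Y ⟶ Z) :
    homAdd r s ≫ g = homAdd (r ≫ g) (s ≫ g) := by
  rw [homAdd, homSum_comp, homAdd]
  congr 1
  funext ⟨j⟩
  cases j <;> rfl

@[simp]
theorem homAdd_zero (r : X ⟶ Y) : homAdd r 0 = r :=
  homSum_eq_single (r := fun j : ULift.{v} Bool => bif j.down then r else 0) ⟨true⟩ <| by
    rintro ⟨_ | _⟩ h <;> trivial

@[simp]
theorem zero_homAdd (r : X ⟶ Y) : homAdd 0 r = r :=
  homSum_eq_single (r := fun j : ULift.{v} Bool => bif j.down then 0 else r) ⟨false⟩ <| by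
    rintro ⟨_ | _⟩ h <;> trivial

theorem homSum_homAdd (r s : J → (X ⟶ Y)) :
    (homSum fun j => homAdd (r j) (s j)) = homAdd (homSum r) (homSum s) := by
  unfold homAdd
  rw [homSum_comm]
  congr 1
  funext ⟨j⟩
  cases j <;> rfl

theorem homAdd_homAdd_homAdd_comm (a b c d : X ⟶ Y) :
    homAdd (homAdd a b) (homAdd c d) = homAdd (homAdd a c) (homAdd b d) := by
  refine Eq.trans ?_ (homSum_homAdd (fun j : ULift.{v} Bool => bif j.down then a else c)
    (fun j => bif j.down then b else d))
  rw [homAdd]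
  congr 1
  funext ⟨j⟩
  cases j <;> rfl

theorem isUnital_homAdd : EckmannHilton.IsUnital homAdd (0 : X ⟶ Y) where
  left_id := zero_homAdd
  right_id := homAdd_zero

theorem homAdd_comm (r s : X ⟶ Y) : homAdd r s = homAdd s r :=
  (EckmannHilton.mul_comm isUnital_homAdd isUnital_homAdd homAdd_homAdd_homAdd_comm).comm r s

theorem homAdd_assoc (r s t : X ⟶ Y) : homAdd (homAdd r s) t = homAdd r (homAdd s t) :=
  (EckmannHilton.mul_assoc isUnital_homAdd isUnital_homAdd homAdd_homAdd_homAdd_comm).assoc r s t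

theorem homAdd_homSum_const_nat (a : X ⟶ Y) :
    homAdd a (homSum fun _ : ULift.{v} ℕ => a) = homSum fun _ : ULift.{v} ℕ => a := by
  let shift (n : ULift.{v} ℕ) : ULift.{v} ℕ := ⟨n.down + 1⟩
  have hshift : shift.Injective := fun m n h => ULift.ext _ _ (by simpa [shift] using h)
  have htail : (homSum fun _ : ULift.{v} ℕ => a) =
      homSum fun n : ULift.{v} ℕ => if n = ⟨0⟩ then 0 else a := by
    rw [← homSum_comp_injective hshift (r := fun n => if n = ⟨0⟩ then 0 else a)]
    · simp [shift]
    · rintro ⟨_ | n⟩ hn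
      · exact if_pos rfl
      · exact absurd ⟨⟨n⟩, rfl⟩ hn
  have hhead : a = homSum fun n : ULift.{v} ℕ => if n = ⟨0⟩ then a else 0 :=
    (homSum_ite_eq _ fun _ => a).symm
  calc homAdd a (homSum fun _ : ULift.{v} ℕ => a)
      = homSum fun n : ULift.{v} ℕ =>
          homAdd (if n = ⟨0⟩ then a else 0) (if n = ⟨0⟩ then 0 else a) := by
        rw [homSum_homAdd, ← hhead, ← htail]
    _ = homSum fun _ : ULift.{v} ℕ => a := by
        congr 1
        funext n
        split_ifs <;> simp

/-- An Eilenberg swindle. -/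
theorem eq_zero_of_homAdd_eq_zero {a b : X ⟶ Y} (h : homAdd a b = 0) : a = 0 := by
  let ω (r : X ⟶ Y) : X ⟶ Y := homSum fun _ : ULift.{v} ℕ => r
  have hω : homAdd (ω a) (ω b) = 0 := by
    simp only [ω, ← homSum_homAdd, h, homSum_zero]
  calc a = homAdd a (homAdd (ω a) (ω b)) := by rw [hω, homAdd_zero]
    _ = homAdd (ω a) (ω b) := by rw [← homAdd_assoc, homAdd_homSum_const_nat]
    _ = 0 := hω

theorem homAdd_eq_zero_iff {r s : X ⟶ Y} : homAdd r s = 0 ↔ r = 0 ∧ s = 0 :=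
  ⟨fun h => ⟨eq_zero_of_homAdd_eq_zero h, eq_zero_of_homAdd_eq_zero (homAdd_comm s r ▸ h)⟩,
    fun ⟨hr, hs⟩ => by rw [hr, hs, homAdd_zero]⟩

theorem homSum_eq_zero_iff {r : J → (X ⟶ Y)} : homSum r = 0 ↔ ∀ j, r j = 0 := by
  classical
  refine ⟨fun h k => ?_, fun h => (congrArg homSum (funext h)).trans homSum_zero⟩
  have hsplit : r = fun j => homAdd (if j = k then r j else 0) (if j = k then 0 else r j) := by
    funext j
    split_ifs <;> simp
  rw [hsplit, homSum_homAdd, homSum_ite_eq] at h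
  exact eq_zero_of_homAdd_eq_zero h

theorem comp_homAdd_comp_eq_zero_iff {f : W ⟶ X} {r s : X ⟶ Y} {g : Y ⟶ Z} :
    f ≫ homAdd r s ≫ g = 0 ↔ f ≫ r ≫ g = 0 ∧ f ≫ s ≫ g = 0 := by
  rw [homAdd_comp, comp_homAdd, homAdd_eq_zero_iff]

theorem comp_homSum_comp_eq_zero_iff {f : W ⟶ X} {r : J → (X ⟶ Y)} {g : Y ⟶ Z} :
    f ≫ homSum r ≫ g = 0 ↔ ∀ j, f ≫ r j ≫ g = 0 := by
  rw [homSum_comp, comp_homSum, homSum_eq_zero_iff]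

end Sums

section PreservesProducts

variable {C D : Type*} [Category.{v} C] [DaggerCategory C] [HasZeroMorphisms C]
  [HasDaggerBiproducts C] [Category.{v} D] [DaggerCategory D] [HasZeroMorphisms D]
  [HasDaggerBiproducts D] (F : C ⥤ D) [F.PreservesZeroMorphisms] {X Y : C}

theorem map_homSum {J : Type v} [PreservesLimitsOfShape (Discrete J) F] (r : J → (X ⟶ Y)) :
    F.map (homSum r) = homSum fun j => F.map (r j) := by
  let B := chosenBiproduct fun _ : J => X
  obtain ⟨t, ht⟩ := B.exists_desc r
  have hdiag : F.map B.diag = homSum fun j => F.map (B.bicone.ι j) := by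
    refine (isLimitOfPreserves F B.isBilimit.isLimit).hom_ext fun ⟨k⟩ => ?_
    change F.map B.diag ≫ F.map (B.bicone.π k) = _ ≫ F.map (B.bicone.π k)
    rw [homSum_comp, homSum_eq_single k, ← F.map_comp, ← F.map_comp, B.diag_π, bicone_ι_π_self]
    intro j hj
    rw [← F.map_comp, bicone_ι_π_ne _ hj, F.map_zero]
  simp only [homSum_eq_diag_comp ht, F.map_comp, hdiag, homSum_comp, ← ht, B]

theorem map_homAdd [PreservesLimitsOfShape (Discrete (ULift.{v} Bool)) F] (r s : X ⟶ Y) :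
    F.map (homAdd r s) = homAdd (F.map r) (F.map s) := by
  rw [homAdd, map_homSum, homAdd]
  congr 1
  funext ⟨j⟩
  cases j <;> rfl

end PreservesProducts

/-- A category with dagger kernels: every morphism has a kernel that is dagger monic. -/
class HasDaggerKernels (C : Type u) [Category.{v} C] [DaggerCategory C] [HasZeroMorphisms C] :
    Prop where
  exists_kernel : ∀ {X Y : C} (f : X ⟶ Y), ∃ (K : C) (k : K ⟶ X), IsKernelOf k f ∧ IsDaggerMono k

/-- A category in which every dagger kernel is complemented: `k` and `k^⊥` are jointly epic. -/
class HasComplementedDaggerKernels (C : Type u) [Category.{v} C] [DaggerCategory C]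
    [HasZeroMorphisms C] : Prop extends HasDaggerKernels C where
  jointlyEpic : ∀ {K K' X : C} (k : K ⟶ X) (k' : K' ⟶ X), IsDaggerKernel k →
    IsComplementOf k' k → JointlyEpic k k'

section Kernels

variable {C : Type u} [Category.{v} C] [HasZeroMorphisms C]

theorem IsKernelOf.exists_fac {K X Y W : C} {k : K ⟶ X} {f : X ⟶ Y} (hk : IsKernelOf k f)
    (g : W ⟶ X) (hg : g ≫ f = 0) : ∃ a : W ⟶ K, a ≫ k = g := by
  obtain ⟨_, ⟨hlim⟩⟩ := hk
  exact ⟨hlim.lift (KernelFork.ofι g hg), hlim.fac _ WalkingParallelPair.zero⟩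

variable [DaggerCategory C]

theorem comp_dagger_self_eq_zero_iff [HasDaggerKernels C] {X Y : C} {f : X ⟶ Y} :
    f ≫ dagger f = 0 ↔ f = 0 := by
  refine ⟨fun h => ?_, fun h => by rw [h, zero_comp]⟩
  obtain ⟨K, k, hk, hmono⟩ := HasDaggerKernels.exists_kernel (dagger f)
  obtain ⟨a, rfl⟩ := hk.exists_fac f h
  have ha : (a ≫ k) ≫ dagger k = 0 := comp_dagger_eq_zero_comm.1 hk.1
  rw [Category.assoc, hmono, Category.comp_id] at ha
  rw [ha, zero_comp]

/-- Here `q = k ∘ k†` and `p = k^⊥ ∘ (k^⊥)†` for a dagger kernel `k` of `f`. -/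
theorem exists_homAdd_eq_id_of_kernel [HasDaggerBiproducts C] [HasComplementedDaggerKernels C]
    {X Y : C} (f : X ⟶ Y) : ∃ p q : X ⟶ X, homAdd p q = 𝟙 X ∧ q ≫ f = 0 ∧
      ∀ {W : C} (z : W ⟶ X), z ≫ f = 0 → z ≫ dagger p = 0 := by
  obtain ⟨K, k, hk, hmono⟩ := HasDaggerKernels.exists_kernel f
  obtain ⟨K', k', hk', hmono'⟩ := HasDaggerKernels.exists_kernel (dagger k)
  have hk'k : k' ≫ dagger k = 0 := hk'.1
  have hkk' : k ≫ dagger k' = 0 := comp_dagger_eq_zero_comm.1 hk'k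
  refine ⟨dagger k' ≫ k', dagger k ≫ k, ?_, by rw [Category.assoc, hk.1, comp_zero], ?_⟩
  · refine HasComplementedDaggerKernels.jointlyEpic k k' ⟨hmono, _, f, hk⟩ ⟨hmono', hk'⟩ _ _ ?_ ?_
    · rw [comp_homAdd, reassoc_of% hkk', reassoc_of% hmono, zero_comp, zero_homAdd,
        Category.comp_id]
    · rw [comp_homAdd, reassoc_of% hk'k, reassoc_of% hmono', zero_comp, homAdd_zero,
        Category.comp_id]
  · intro W z hz
    obtain ⟨a, rfl⟩ := hk.exists_fac z hz
    rw [dagger_comp, dagger_dagger, Category.assoc, reassoc_of% hkk', zero_comp, comp_zero]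

end Kernels

/-- The monoidal unit `I` is a nonzero separator whose nonzero endomorphisms are invertible. -/
class HasSimpleSeparatingUnit (C : Type u) [Category.{v} C] [MonoidalCategory C]
    [HasZeroMorphisms C] : Prop where
  unit_nonzero : ¬ IsZero (𝟙_ C)
  isIso_of_ne_zero : ∀ f : 𝟙_ C ⟶ 𝟙_ C, f ≠ 0 → IsIso f
  unit_separator : IsSeparator (𝟙_ C)

section Scalars

variable {C : Type u} [Category.{v} C] [MonoidalCategory C] [HasZeroMorphisms C]
  [HasSimpleSeparatingUnit C] {X Y : C}

theorem id_unit_ne_zero : 𝟙 (𝟙_ C) ≠ 0 := fun h =>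
  HasSimpleSeparatingUnit.unit_nonzero ((IsZero.iff_id_eq_zero _).2 h)

theorem hom_ext_unit {r s : X ⟶ Y} (h : ∀ x : 𝟙_ C ⟶ X, x ≫ r = x ≫ s) : r = s :=
  (isSeparator_def _).1 HasSimpleSeparatingUnit.unit_separator _ _ h

variable [DaggerCategory C] [HasDaggerBiproducts C]

/-- Multiplication by a unit `s` permutes the scalars, so it fixes their sum, which is a unit. -/
theorem scalar_eq_id {s : 𝟙_ C ⟶ 𝟙_ C} (hs : s ≠ 0) : s = 𝟙 (𝟙_ C) := by
  have := HasSimpleSeparatingUnit.isIso_of_ne_zero s hs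
  let total : 𝟙_ C ⟶ 𝟙_ C := homSum fun t : 𝟙_ C ⟶ 𝟙_ C => t
  have := HasSimpleSeparatingUnit.isIso_of_ne_zero total fun h =>
    id_unit_ne_zero (homSum_eq_zero_iff.1 h (𝟙 _))
  have hinj : Function.Injective fun t : 𝟙_ C ⟶ 𝟙_ C => s ≫ t := fun t t' => (cancel_epi s).1
  have hfix : s ≫ total = total := by
    refine (comp_homSum s _).trans (homSum_comp_injective hinj (r := fun t => t) fun t ht => ?_)
    exact absurd ⟨inv s ≫ t, IsIso.hom_inv_id_assoc s t⟩ ht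
  rw [← cancel_mono total, hfix, Category.id_comp]

theorem scalar_eq_id_iff {s : 𝟙_ C ⟶ 𝟙_ C} : s = 𝟙 (𝟙_ C) ↔ s ≠ 0 :=
  ⟨fun h => h ▸ id_unit_ne_zero, scalar_eq_id⟩

theorem scalar_ext {s t : 𝟙_ C ⟶ 𝟙_ C} (h : s = 0 ↔ t = 0) : s = t := by
  by_cases hs : s = 0
  · rw [hs, h.1 hs]
  · rw [scalar_eq_id hs, scalar_eq_id (h.not.1 hs)]

theorem hom_ext_of_zero_iff {r s : X ⟶ Y}
    (h : ∀ (x : 𝟙_ C ⟶ X) (y : 𝟙_ C ⟶ Y), x ≫ r ≫ dagger y = 0 ↔ x ≫ s ≫ dagger y = 0) :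
    r = s := by
  refine hom_ext_unit fun x => ?_
  rw [← dagger_dagger (x ≫ r), ← dagger_dagger (x ≫ s)]
  refine congrArg dagger (hom_ext_unit fun y => scalar_ext ?_)
  rw [comp_dagger_eq_zero_comm, Category.assoc, h, comp_dagger_eq_zero_comm, Category.assoc]

end Scalars

section Order

variable {C : Type u} [Category.{v} C] [MonoidalCategory C] [HasZeroMorphisms C]
  [HasSimpleSeparatingUnit C] [DaggerCategory C] [HasDaggerBiproducts C] {X Y Z : C}

/-- The order `r ≤ s ↔ r + s = s` on a hom-set. -/
scoped instance : LE (X ⟶ Y) :=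
  ⟨HomLE⟩

theorem le_iff {r s : X ⟶ Y} : r ≤ s ↔
    ∀ (x : 𝟙_ C ⟶ X) (y : 𝟙_ C ⟶ Y), x ≫ s ≫ dagger y = 0 → x ≫ r ≫ dagger y = 0 := by
  change homAdd r s = s ↔ _
  constructor
  · intro h x y hs
    rw [← h, comp_homAdd_comp_eq_zero_iff] at hs
    exact hs.1
  · intro h
    refine hom_ext_of_zero_iff fun x y => ?_
    rw [comp_homAdd_comp_eq_zero_iff]
    exact and_iff_right_of_imp (h x y)

scoped instance : PartialOrder (X ⟶ Y) where
  le_refl _ := le_iff.2 fun _ _ h => h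
  le_trans _ _ _ hrs hst := le_iff.2 fun x y h => le_iff.1 hrs x y (le_iff.1 hst x y h)
  le_antisymm _ _ hrs hsr := hom_ext_of_zero_iff fun x y => ⟨le_iff.1 hsr x y, le_iff.1 hrs x y⟩

noncomputable scoped instance : SupSet (X ⟶ Y) where
  sSup S := homSum fun r : S => r.1

theorem isLUB_sSup_hom (S : Set (X ⟶ Y)) : IsLUB S (sSup S) := by
  refine ⟨fun r hr => le_iff.2 fun x y h => ?_, fun s hs => le_iff.2 fun x y h => ?_⟩
  · exact comp_homSum_comp_eq_zero_iff.1 h ⟨r, hr⟩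
  · exact comp_homSum_comp_eq_zero_iff.2 fun r => le_iff.1 (hs r.2) x y h

/-- Suprema are sums of morphisms; binary ones are given by `homAdd` and the empty one by `0`. -/
noncomputable scoped instance : CompleteLattice (X ⟶ Y) where
  __ := completeLatticeOfSup (X ⟶ Y) isLUB_sSup_hom
  bot := 0
  bot_le := zero_homAdd
  sup := homAdd
  le_sup_left _ _ := le_iff.2 fun _ _ h => (comp_homAdd_comp_eq_zero_iff.1 h).1
  le_sup_right _ _ := le_iff.2 fun _ _ h => (comp_homAdd_comp_eq_zero_iff.1 h).2
  sup_le _ _ _ hr hs := le_iff.2 fun x y h =>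
    comp_homAdd_comp_eq_zero_iff.2 ⟨le_iff.1 hr x y h, le_iff.1 hs x y h⟩

theorem comp_sup (f : X ⟶ Y) (r s : Y ⟶ Z) : f ≫ (r ⊔ s) = f ≫ r ⊔ f ≫ s :=
  comp_homAdd f r s

theorem sup_comp (r s : X ⟶ Y) (g : Y ⟶ Z) : (r ⊔ s) ≫ g = r ≫ g ⊔ s ≫ g :=
  homAdd_comp r s g

theorem comp_le_comp {r r' : X ⟶ Y} {s s' : Y ⟶ Z} (hr : r ≤ r') (hs : s ≤ s') :
    r ≫ s ≤ r' ≫ s' := by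
  rw [← sup_eq_right.2 hr, ← sup_eq_right.2 hs, sup_comp, comp_sup]
  exact le_sup_of_le_left le_sup_left

theorem le_of_forall_comp_le {r s : X ⟶ Y} (h : ∀ x : 𝟙_ C ⟶ X, x ≫ r ≤ x ≫ s) : r ≤ s :=
  sup_eq_right.1 <| hom_ext_unit fun x => (comp_sup x r s).trans (sup_eq_right.2 (h x))

theorem dagger_le_dagger {r s : X ⟶ Y} (h : r ≤ s) : dagger r ≤ dagger s := by
  refine le_iff.2 fun y x hs => ?_
  rw [← Category.assoc, comp_dagger_eq_zero_comm, dagger_comp, dagger_dagger] at hs ⊢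
  exact le_iff.1 h x y hs

theorem isHomAtom_iff_isAtom {a : X ⟶ Y} : IsHomAtom a ↔ IsAtom a := by
  refine and_congr Iff.rfl (forall_congr' fun b => ?_)
  rw [lt_iff_le_and_ne, and_imp, or_iff_not_imp_right]
  exact Iff.rfl

theorem state_le_iff {x y : 𝟙_ C ⟶ X} :
    x ≤ y ↔ ∀ z : 𝟙_ C ⟶ X, y ≫ dagger z = 0 → x ≫ dagger z = 0 := by
  refine ⟨fun h z hz => le_bot_iff.1 ((comp_le_comp h le_rfl).trans_eq hz), fun h => le_iff.2 ?_⟩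
  intro s z hz
  by_cases hs : s = 0
  · rw [hs, zero_comp]
  · rw [scalar_eq_id hs, Category.id_comp] at hz ⊢
    exact h z hz

end Order

section Boolean

variable {C : Type u} [Category.{v} C] [MonoidalCategory C] [HasZeroMorphisms C]
  [HasSimpleSeparatingUnit C] [DaggerCategory C] [HasDaggerBiproducts C] {X Y : C}

theorem disjoint_of_comp_dagger_eq_zero [HasDaggerKernels C] {r s : X ⟶ Y}
    (h : r ≫ dagger s = 0) : Disjoint r s := by
  refine disjoint_iff_inf_le.2 (comp_dagger_self_eq_zero_iff.1 (le_bot_iff.1 ?_)).le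
  exact (comp_le_comp inf_le_left (dagger_le_dagger inf_le_right)).trans_eq h

variable [HasComplementedDaggerKernels C]

/-- `p` and `q` are the projections onto `w` and onto its complement. -/
theorem exists_projections (w : 𝟙_ C ⟶ X) : ∃ p q : X ⟶ X, p ⊔ q = 𝟙 X ∧ q ≫ dagger w = 0 ∧
    ∀ x : 𝟙_ C ⟶ X, x ≫ p ≤ w := by
  obtain ⟨p, q, hpq, hq, hp⟩ := exists_homAdd_eq_id_of_kernel (dagger w)
  refine ⟨p, q, hpq, hq, fun x => state_le_iff.2 fun z hz => ?_⟩
  have hzp : z ≫ dagger p = 0 := hp z (comp_dagger_eq_zero_comm.1 hz)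
  rw [Category.assoc, comp_dagger_eq_zero_comm.1 hzp, comp_zero]

theorem exists_sup_eq (x w : 𝟙_ C ⟶ X) :
    ∃ u u' : 𝟙_ C ⟶ X, u ⊔ u' = x ∧ u ≤ w ∧ u' ≫ dagger w = 0 := by
  obtain ⟨p, q, hpq, hq, hp⟩ := exists_projections w
  refine ⟨x ≫ p, x ≫ q, ?_, hp x, by rw [Category.assoc, hq, comp_zero]⟩
  rw [← comp_sup, hpq, Category.comp_id]

theorem disjoint_iff_comp_dagger_eq_zero {x y : 𝟙_ C ⟶ X} :
    Disjoint x y ↔ x ≫ dagger y = 0 := by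
  refine ⟨fun h => ?_, disjoint_of_comp_dagger_eq_zero⟩
  obtain ⟨u, u', rfl, hu, hu'⟩ := exists_sup_eq x y
  have hu₀ : u = 0 := le_bot_iff.1 (h le_sup_left hu)
  rw [sup_comp, hu', hu₀, zero_comp]
  exact sup_idem _

theorem disjoint_sup_left_of_disjoint {x y z : 𝟙_ C ⟶ X} (hx : Disjoint x z)
    (hy : Disjoint y z) : Disjoint (x ⊔ y) z := by
  rw [disjoint_iff_comp_dagger_eq_zero] at hx hy ⊢
  rw [sup_comp, hx, hy]
  exact sup_idem _

noncomputable scoped instance : DistribLattice (𝟙_ C ⟶ X) :=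
  DistribLattice.ofInfSupLe fun a b c => by
    obtain ⟨u, u', hu, hle, hu'⟩ := exists_sup_eq (a ⊓ (b ⊔ c)) (a ⊓ b ⊔ a ⊓ c)
    have hdisj : Disjoint (a ⊓ b ⊔ a ⊓ c) u' := (disjoint_of_comp_dagger_eq_zero hu').symm
    obtain ⟨hu'a, hu'bc⟩ : u' ≤ a ∧ u' ≤ b ⊔ c := le_inf_iff.1 (hu ▸ le_sup_right)
    have hb : Disjoint b u' := fun z hzb hz =>
      hdisj (le_sup_of_le_left (le_inf (hz.trans hu'a) hzb)) hz
    have hc : Disjoint c u' := fun z hzc hz =>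
      hdisj (le_sup_of_le_right (le_inf (hz.trans hu'a) hzc)) hz
    have hu'₀ : u' = ⊥ := (disjoint_sup_left_of_disjoint hb hc).eq_bot_of_ge hu'bc
    rwa [← hu, hu'₀, sup_bot_eq]

instance : ComplementedLattice (𝟙_ C ⟶ X) where
  exists_isCompl u := by
    obtain ⟨w, u', htop, hw, hu'⟩ := exists_sup_eq ⊤ u
    refine ⟨u', (disjoint_of_comp_dagger_eq_zero hu').symm, codisjoint_iff_le_sup.2 ?_⟩
    exact htop.ge.trans (sup_le_sup_right hw u')

noncomputable scoped instance : BooleanAlgebra (𝟙_ C ⟶ X) :=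
  DistribLattice.booleanAlgebraOfComplemented _

end Boolean

section Closed

variable {C : Type u} [Category.{v} C] [MonoidalCategory C] [MonoidalClosed C] {X Y : C}

/-- A morphism `X ⟶ Y` corresponds to its name, a state of the internal hom `[X, Y]`. -/
def nameEquiv (X Y : C) : (X ⟶ Y) ≃ (𝟙_ C ⟶ (ihom X).obj Y) :=
  (ρ_ X).symm.homFromEquiv.trans ((ihom.adjunction X).homEquiv _ _)

theorem nameEquiv_eq_comp (r : X ⟶ Y) :
    nameEquiv X Y r = nameEquiv X X (𝟙 X) ≫ (ihom X).map r := by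
  simpa [nameEquiv] using (ihom.adjunction X).homEquiv_naturality_right (ρ_ X).hom r

variable [DaggerCategory C] [HasZeroMorphisms C] [HasDaggerBiproducts C]

theorem nameEquiv_homAdd (r s : X ⟶ Y) :
    nameEquiv X Y (homAdd r s) = homAdd (nameEquiv X Y r) (nameEquiv X Y s) := by
  have : (ihom X).IsRightAdjoint := (ihom.adjunction X).isRightAdjoint
  have : PreservesLimitsOfSize.{0, v} (ihom X) := (ihom.adjunction X).rightAdjoint_preservesLimits
  rw [nameEquiv_eq_comp, map_homAdd, comp_homAdd, ← nameEquiv_eq_comp, ← nameEquiv_eq_comp]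

variable [HasSimpleSeparatingUnit C]

/-- Taking names is an isomorphism of lattices, since it preserves sums. -/
noncomputable def nameOrderIso (X Y : C) : (X ⟶ Y) ≃o (𝟙_ C ⟶ (ihom X).obj Y) where
  toEquiv := nameEquiv X Y
  map_rel_iff' {r s} := by
    change homAdd (nameEquiv X Y r) (nameEquiv X Y s) = nameEquiv X Y s ↔ homAdd r s = s
    rw [← nameEquiv_homAdd, EmbeddingLike.apply_eq_iff_eq]

instance [HasComplementedDaggerKernels C] : ComplementedLattice (X ⟶ Y) :=
  (nameOrderIso X Y).symm.complementedLattice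

end Closed

section Atomic

variable {C : Type u} [Category.{v} C] [MonoidalCategory C]
  [HasZeroMorphisms C] [HasSimpleSeparatingUnit C] [DaggerCategory C] [HasDaggerBiproducts C]
  {X Y : C}

theorem comp_top [HasDaggerKernels C] {y : 𝟙_ C ⟶ X} (hy : y ≠ 0) :
    y ≫ (⊤ : X ⟶ Y) = ⊤ := by
  have hyy : y ≫ dagger y = 𝟙 (𝟙_ C) := scalar_eq_id (comp_dagger_self_eq_zero_iff.not.2 hy)
  refine top_le_iff.1 ?_
  calc ⊤ = y ≫ dagger y ≫ ⊤ := by rw [reassoc_of% hyy]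
    _ ≤ y ≫ ⊤ := comp_le_comp le_rfl le_top

theorem sup_comp_eq_top [HasDaggerKernels C] {n : X ⟶ X} (hn : Codisjoint (𝟙 X) n)
    {y : 𝟙_ C ⟶ X} (hy : y ≠ 0) : y ⊔ y ≫ n = ⊤ := by
  rw [← comp_top hy, ← hn.eq_top, comp_sup, Category.comp_id]

variable [HasComplementedDaggerKernels C]

theorem comp_eq_top_of_not_isAtom {n : X ⟶ X} (hn : Codisjoint (𝟙 X) n) {y : 𝟙_ C ⟶ X}
    (hy : y ≠ ⊥) (hatom : ¬ IsAtom y) : y ≫ n = ⊤ := by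
  obtain ⟨b, hby, hb⟩ : ∃ b < y, b ≠ ⊥ := by simpa [IsAtom, hy] using hatom
  have hcover {z : 𝟙_ C ⟶ X} (hz : z ≠ ⊥) (hzy : z ≤ y) : z ⊔ y ≫ n = ⊤ :=
    top_le_iff.1 <| (sup_comp_eq_top hn hz).ge.trans
      (sup_le_sup_left (comp_le_comp hzy le_rfl) z)
  have hc : y \ b ≠ ⊥ := fun h => hby.not_ge (sdiff_eq_bot_iff.1 h)
  calc y ≫ n = b ⊓ y \ b ⊔ y ≫ n := by rw [inf_sdiff_self_right, bot_sup_eq]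
    _ = ⊤ := by rw [sup_inf_right, hcover hb hby.le, hcover hc sdiff_le, inf_top_eq]

instance [MonoidalClosed C] : IsAtomic (𝟙_ C ⟶ X) where
  eq_bot_or_exists_atom_le x := by
    by_contra! h
    obtain ⟨hx, hatom⟩ := h
    obtain ⟨p, q, hpq, hq, hp⟩ := exists_projections x
    obtain ⟨n, hn⟩ := exists_isCompl (𝟙 X)
    have hp₁ : p ≤ 𝟙 X := hpq ▸ le_sup_left
    have hpn : p ≤ n := by
      refine le_of_forall_comp_le fun y => ?_
      by_cases hyp : y ≫ p = ⊥
      · exact hyp.trans_le bot_le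
      have htop : (y ≫ p) ≫ n = ⊤ :=
        comp_eq_top_of_not_isAtom hn.codisjoint hyp fun ha => hatom _ ha (hp y)
      calc y ≫ p ≤ (y ≫ p) ≫ n := le_top.trans_eq htop.symm
        _ ≤ y ≫ n := comp_le_comp ((comp_le_comp le_rfl hp₁).trans_eq (Category.comp_id y)) le_rfl
    have hp₀ : p = 0 := le_bot_iff.1 (hn.disjoint hp₁ hpn)
    refine hx (dagger_eq_zero_iff.1 ?_)
    rw [← Category.id_comp (dagger x), ← hpq, sup_comp, hq, hp₀, zero_comp]
    exact sup_idem _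

end Atomic

section AtomFunctor

variable {C : Type u} [Category.{v} C] [MonoidalCategory C]
  [HasZeroMorphisms C] [HasSimpleSeparatingUnit C] [DaggerCategory C] [HasDaggerBiproducts C]
  {X Y : C}

theorem mem_atomPrefunctor_map {r : X ⟶ Y} {x : {x : 𝟙_ C ⟶ X // IsHomAtom x}}
    {y : {y : 𝟙_ C ⟶ Y // IsHomAtom y}} :
    (x, y) ∈ ((atomPrefunctor C).map r).rel ↔ x.1 ≫ r ≫ dagger y.1 ≠ 0 :=
  scalar_eq_id_iff

theorem atomPrefunctor_map_dagger (r : X ⟶ Y) :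
    (atomPrefunctor C).map (dagger r) = dagger ((atomPrefunctor C).map r) := by
  apply RelCat.Hom.ext
  ext ⟨b, a⟩
  refine mem_atomPrefunctor_map.trans (Iff.trans ?_ (mem_atomPrefunctor_map (r := r)).symm)
  rw [← Category.assoc, Ne, comp_dagger_eq_zero_comm, dagger_comp, dagger_dagger]

variable [HasComplementedDaggerKernels C]

namespace IsHomAtom

variable {a b x : 𝟙_ C ⟶ X}

theorem comp_dagger_ne_zero_iff_le (ha : IsHomAtom a) : a ≫ dagger x ≠ 0 ↔ a ≤ x := by
  rw [Ne, ← disjoint_iff_comp_dagger_eq_zero, (isHomAtom_iff_isAtom.1 ha).not_disjoint_iff_le]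

theorem comp_dagger_ne_zero_iff_eq (ha : IsHomAtom a) (hb : IsHomAtom b) :
    a ≫ dagger b ≠ 0 ↔ a = b := by
  rw [ha.comp_dagger_ne_zero_iff_le, (isHomAtom_iff_isAtom.1 hb).le_iff_eq ha.1]

end IsHomAtom

theorem comp_dagger_comp_dagger_ne_zero_iff {a a' : {a : 𝟙_ C ⟶ X // IsHomAtom a}}
    {b b' : {b : 𝟙_ C ⟶ Y // IsHomAtom b}} :
    a.1 ≫ (dagger a'.1 ≫ b'.1) ≫ dagger b.1 ≠ 0 ↔ a = a' ∧ b' = b := by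
  have hprod : a.1 ≫ (dagger a'.1 ≫ b'.1) ≫ dagger b.1 =
      (a.1 ≫ dagger a'.1) ≫ b'.1 ≫ dagger b.1 := by simp only [Category.assoc]
  rw [Subtype.ext_iff, Subtype.ext_iff, ← a.2.comp_dagger_ne_zero_iff_eq a'.2,
    ← b'.2.comp_dagger_ne_zero_iff_eq b.2, hprod]
  refine ⟨fun h => ⟨fun ha => h ?_, fun hb => h ?_⟩, fun ⟨ha, hb⟩ => ?_⟩
  · rw [ha, zero_comp]
  · rw [hb, comp_zero]
  · rwa [scalar_eq_id ha, Category.id_comp]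

variable [MonoidalClosed C]

/-- The matrix product formula: morphisms compose like the relations between atoms. -/
theorem comp_ne_zero_iff_exists_atom {x : 𝟙_ C ⟶ X} {f : X ⟶ 𝟙_ C} :
    x ≫ f ≠ 0 ↔ ∃ a : {a : 𝟙_ C ⟶ X // IsHomAtom a}, x ≫ dagger a.1 ≠ 0 ∧ a.1 ≫ f ≠ 0 := by
  obtain ⟨y, rfl⟩ : ∃ y : 𝟙_ C ⟶ X, f = dagger y := ⟨dagger f, (dagger_dagger f).symm⟩
  have hle (a : {a : 𝟙_ C ⟶ X // IsHomAtom a}) :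
      x ≫ dagger a.1 ≠ 0 ∧ a.1 ≫ dagger y ≠ 0 ↔ a.1 ≤ x ⊓ y := by
    rw [le_inf_iff, ← a.2.comp_dagger_ne_zero_iff_le, ← a.2.comp_dagger_ne_zero_iff_le, Ne, Ne,
      comp_dagger_eq_zero_comm]
  simp only [hle]
  rw [Ne, ← disjoint_iff_comp_dagger_eq_zero, disjoint_iff]
  constructor
  · intro h
    obtain ⟨a, ha, hle⟩ := (eq_bot_or_exists_atom_le (x ⊓ y)).resolve_left h
    exact ⟨⟨a, isHomAtom_iff_isAtom.2 ha⟩, hle⟩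
  · rintro ⟨a, ha⟩ h
    exact a.2.1 (le_bot_iff.1 (ha.trans_eq h))

theorem hom_ext_atoms {r s : X ⟶ Y} (h : ∀ (a : {a : 𝟙_ C ⟶ X // IsHomAtom a})
    (b : {b : 𝟙_ C ⟶ Y // IsHomAtom b}),
    a.1 ≫ r ≫ dagger b.1 ≠ 0 ↔ a.1 ≫ s ≫ dagger b.1 ≠ 0) : r = s := by
  refine hom_ext_of_zero_iff fun x y => not_iff_not.1 ?_
  rw [← Ne, ← Ne, comp_ne_zero_iff_exists_atom, comp_ne_zero_iff_exists_atom]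
  refine exists_congr fun a => and_congr_right fun _ => ?_
  rw [← Category.assoc, comp_ne_zero_iff_exists_atom, ← Category.assoc,
    comp_ne_zero_iff_exists_atom]
  simp only [Category.assoc, h]

variable (C) in
/-- The prefunctor of atoms, as a functor to the category of sets and relations. -/
def atomFunctor : C ⥤ RelCat.{v} where
  obj := (atomPrefunctor C).obj
  map := (atomPrefunctor C).map
  map_id X := by
    apply RelCat.Hom.ext
    ext ⟨a, b⟩
    refine mem_atomPrefunctor_map.trans ?_
    rw [Category.id_comp]
    exact (a.2.comp_dagger_ne_zero_iff_eq b.2).trans Subtype.ext_iff.symm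
  map_comp r s := by
    apply RelCat.Hom.ext
    ext ⟨a, c⟩
    refine mem_atomPrefunctor_map.trans ?_
    rw [Category.assoc, ← Category.assoc, comp_ne_zero_iff_exists_atom]
    refine exists_congr fun b => and_congr ?_ mem_atomPrefunctor_map.symm
    rw [Category.assoc]
    exact mem_atomPrefunctor_map.symm

instance : (atomFunctor C).Faithful where
  map_injective {X Y r s} h := by
    have h' : (atomPrefunctor C).map r = (atomPrefunctor C).map s := h
    refine hom_ext_atoms fun a b => ?_
    rw [← mem_atomPrefunctor_map, ← mem_atomPrefunctor_map, h']

instance : (atomFunctor C).Full where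
  map_surjective {X Y} R := by
    let S : SetRel {x : 𝟙_ C ⟶ X // IsHomAtom x} {y : 𝟙_ C ⟶ Y // IsHomAtom y} := R.rel
    refine ⟨homSum fun p : S => dagger p.1.1.1 ≫ p.1.2.1, ?_⟩
    apply RelCat.Hom.ext
    ext ⟨a, b⟩
    refine mem_atomPrefunctor_map.trans ?_
    rw [Ne, comp_homSum_comp_eq_zero_iff, not_forall]
    refine (exists_congr fun p => comp_dagger_comp_dagger_ne_zero_iff).trans ⟨?_, fun h => ?_⟩
    · rintro ⟨⟨⟨a', b'⟩, h⟩, rfl, rfl⟩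
      exact h
    · exact ⟨⟨(a, b), h⟩, rfl, rfl⟩

end AtomFunctor

namespace DaggerBiproduct

variable {C : Type u} [Category.{v} C] [MonoidalCategory C]
  [HasZeroMorphisms C] [HasSimpleSeparatingUnit C] [DaggerCategory C]
  {M : Type v} (A : DaggerBiproduct fun _ : M => 𝟙_ C)

theorem ι_comp_dagger_ι_ne_zero_iff {j k : M} :
    A.bicone.ι j ≫ dagger (A.bicone.ι k) ≠ 0 ↔ j = k := by
  rw [A.dagger_ι]
  rcases eq_or_ne j k with rfl | hjk
  · simpa using id_unit_ne_zero
  · simp [bicone_ι_π_ne _ hjk, hjk]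

variable [HasDaggerBiproducts C]

theorem isHomAtom_ι (j : M) : IsHomAtom (A.bicone.ι j) := by
  refine ⟨fun h => A.ι_comp_dagger_ι_ne_zero_iff.2 rfl (by rw [h, zero_comp]), fun b hb => ?_⟩
  have hb' : b = (b ≫ A.bicone.π j) ≫ A.bicone.ι j := by
    refine A.hom_ext_π fun k => ?_
    rcases eq_or_ne j k with rfl | hjk
    · simp
    · rw [Category.assoc, bicone_ι_π_ne _ hjk, comp_zero, ← A.dagger_ι]
      refine state_le_iff.1 hb _ ?_
      rw [A.dagger_ι, bicone_ι_π_ne _ hjk]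
  rw [hb']
  by_cases hs : b ≫ A.bicone.π j = 0
  · exact Or.inl (by rw [hs, zero_comp])
  · exact Or.inr (by rw [scalar_eq_id hs, Category.id_comp])

theorem bijective_ι [HasComplementedDaggerKernels C] : Function.Bijective fun j : M =>
    (⟨A.bicone.ι j, A.isHomAtom_ι j⟩ : {x : 𝟙_ C ⟶ A.pt // IsHomAtom x}) := by
  refine ⟨fun j k h => ?_, fun ⟨a, ha⟩ => ?_⟩
  · exact A.ι_comp_dagger_ι_ne_zero_iff.1
      (((A.isHomAtom_ι j).comp_dagger_ne_zero_iff_eq (A.isHomAtom_ι k)).2 (congrArg Subtype.val h))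
  · obtain ⟨j, hj⟩ : ∃ j, a ≫ A.bicone.π j ≠ 0 := by
      by_contra! h
      exact ha.1 (A.hom_ext_π fun j => (h j).trans zero_comp.symm)
    rw [← A.dagger_ι, ha.comp_dagger_ne_zero_iff_eq (A.isHomAtom_ι j)] at hj
    exact ⟨j, Subtype.ext hj.symm⟩

end DaggerBiproduct

theorem exists_isDaggerIso_of_bijective {M N : RelCat.{v}} {f : M → N} (hf : f.Bijective) :
    ∃ i : M ⟶ N, IsDaggerIso i := by
  refine ⟨RelCat.Hom.ofRel {p : M × N | f p.1 = p.2}, RelCat.Hom.ext _ _ ?_, RelCat.Hom.ext _ _ ?_⟩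
  · ext ⟨a, b⟩
    change (∃ c : N, f a = c ∧ f b = c) ↔ a = b
    exact ⟨fun ⟨c, hac, hbc⟩ => hf.injective (hac.trans hbc.symm),
      fun h => ⟨f a, rfl, congrArg f h.symm⟩⟩
  · ext ⟨a, b⟩
    change (∃ c : M, f c = a ∧ f c = b) ↔ a = b
    exact ⟨fun ⟨c, hca, hcb⟩ => hca.symm.trans hcb,
      fun h => (hf.surjective a).imp fun c hca => ⟨hca, hca.trans h⟩⟩

theorem DaggerCompactClosed.nonempty_monoidalClosed (C : Type u) [Category.{v} C]
    [MonoidalCategory C] [SymmetricCategory C] [DaggerCategory C] [DaggerCompactClosed C] :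
    Nonempty (MonoidalClosed C) := by
  choose dual pairing _ using exists_daggerDual (C := C)
  let (X : C) : HasLeftDual X := { leftDual := dual X, exact := pairing X }
  exact ⟨{ closed := fun X => closedOfHasLeftDual X }⟩

end DaggerCategory

open DaggerCategory in
theorem proposition8_general {C : Type u} [Category.{v} C] [MonoidalCategory C]
    [MonoidalClosed C] [DaggerCategory C] [HasZeroMorphisms C] [HasDaggerBiproducts C]
    (exists_kernel : ∀ {X Y : C} (f : X ⟶ Y), ∃ (K : C) (k : K ⟶ X),
      IsKernelOf k f ∧ IsDaggerMono k)
    (jointlyEpic : ∀ {K K' X : C} (k : K ⟶ X) (k' : K' ⟶ X), IsDaggerKernel k →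
      IsComplementOf k' k → JointlyEpic k k')
    (unit_nonzero : ¬ IsZero (𝟙_ C))
    (isIso_of_ne_zero : ∀ f : 𝟙_ C ⟶ 𝟙_ C, f ≠ 0 → IsIso f)
    (unit_separator : IsSeparator (𝟙_ C)) :
    ∃ E : C ⥤ RelCat.{v}, E.toPrefunctor = atomPrefunctor C ∧ IsDaggerEquivalence E ∧
      ∀ (M : RelCat.{v}) (A : DaggerBiproduct (fun _ : M => 𝟙_ C)),
        ∃ i : M ⟶ E.obj A.pt, IsDaggerIso i := by
  have : HasSimpleSeparatingUnit C := ⟨unit_nonzero, isIso_of_ne_zero, unit_separator⟩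
  have : HasComplementedDaggerKernels C := { exists_kernel, jointlyEpic }
  have iso_obj_pt (M : RelCat.{v}) (A : DaggerBiproduct (fun _ : M => 𝟙_ C)) :
      ∃ i : M ⟶ (atomFunctor C).obj A.pt, IsDaggerIso i :=
    exists_isDaggerIso_of_bijective A.bijective_ι
  exact ⟨atomFunctor C, rfl,
    { full := inferInstance
      faithful := inferInstance
      map_dagger := atomPrefunctor_map_dagger
      exists_daggerIso := fun M => ⟨_, iso_obj_pt M (chosenBiproduct _)⟩ },
    iso_obj_pt⟩

theorem proposition8 {C : Type u} [Category.{v} C] [MonoidalCategory C] [SymmetricCategory C]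
    [DaggerCategory C] [DaggerCategory.DaggerCompactClosed C] [HasZeroMorphisms C]
    [DaggerCategory.HasDaggerBiproducts C]
    (exists_kernel : ∀ {X Y : C} (f : X ⟶ Y), ∃ (K : C) (k : K ⟶ X),
      DaggerCategory.IsKernelOf k f ∧ DaggerCategory.IsDaggerMono k)
    (jointlyEpic : ∀ {K K' X : C} (k : K ⟶ X) (k' : K' ⟶ X), DaggerCategory.IsDaggerKernel k →
      DaggerCategory.IsComplementOf k' k → DaggerCategory.JointlyEpic k k')
    (unit_nonzero : ¬ IsZero (𝟙_ C))
    (isIso_of_ne_zero : ∀ f : 𝟙_ C ⟶ 𝟙_ C, f ≠ 0 → IsIso f)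
    (unit_separator : IsSeparator (𝟙_ C)) :
    ∃ E : C ⥤ RelCat.{v}, E.toPrefunctor = DaggerCategory.atomPrefunctor C ∧
      DaggerCategory.IsDaggerEquivalence E ∧
      ∀ (M : RelCat.{v}) (A : DaggerCategory.DaggerBiproduct (fun _ : M => 𝟙_ C)),
        ∃ i : M ⟶ E.obj A.pt, DaggerCategory.IsDaggerIso i := by
  obtain ⟨_⟩ := DaggerCategory.DaggerCompactClosed.nonempty_monoidalClosed C
  exact proposition8_general exists_kernel jointlyEpic unit_nonzero isIso_of_ne_zero unit_separator
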